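/- Let $\mathbb B^d=\{x\in\mathbb R^d:\|x\|_2\le1\}$, $\mathbb S^d=\{v\in\mathbb R^{d+1}:\|v\|_2=1\}$ and $\sigma(t)=\max\{t,0\}$. For $N\in\mathbb N$ let $\mathcal{NN}(N)$ be the set of functions $\mathbb B^d\to\mathbb R$ of the form $x\mapsto\sum_{i=1}^N a_i\,\sigma((x^\intercal,1)w_i)$ with $a_i\in\mathbb R$, $w_i\in\mathbb R^{d+1}$. For $f$ in some $\mathcal{NN}(N)$ let $\kappa(f)$ be the infimum of $\|\mu\|=\sum_k|c_k|$ over all finitely supported signed measures $\mu=\sum_{k}c_k\delta_{v_k}$ on $\mathbb S^d$ (distinct $v_k\in\mathbb S^d$, any finite number of them) such that $f(x)=\int_{\mathbb S^d}\sigma((x^\intercal,1)v)\,d\mu(v)$ for all $x\in\mathbb B^d$. For $R>0$ put $\mathcal F_{N,R}=\{f\in\mathcal{NN}(N):\kappa(f)\le R\}$. For a class $\mathcal F$ of real functions on $\mathbb B^d$ put $\partial\mathcal F=\{f_1-f_2:f_1,f_2\in\mathcal F\}$ and $\mathrm{star}(\mathcal F)=\{af:f\in\mathcal F,\ a\in[0,1]\}$.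 Given points $X_1,\dots,X_n\in\mathbb B^d$, let $\|f\|_n^2=\frac1n\sum_{i=1}^n f(X_i)^2$ and, for independent zero-mean random variables $\xi_1,\dots,\xi_n$ and $\delta>0$, define the local complexity $$\mathcal G_n(\mathcal F;\delta,\xi_{1:n})=\mathbb E\Big[\sup_{f\in\mathcal F,\ \|f\|_n\le\delta}\Big|\frac1n\sum_{i=1}^n\xi_i f(X_i)\Big|\Big].$$ There are absolute constants $c_1,c_2>0$ with the following property. Let $n\ge1$, let $d,N$ be natural numbers, let $X_1,\dots,X_n\in\mathbb B^d$ be fixed points, $h:\mathbb B^d\to\mathbb R$ a fixed function, and let $B>0$, $R>0$, $c_0\ge1$. Let $\eta_1,\dots,\eta_n$ be independent random variables on a probability space with $\mathbb E[\eta_i]=0$ and $|\eta_i|\le2B$ almost surely. Let $\delta_n>0$ satisfy $$\mathcal G_n(\mathrm{star}(\partial\mathcal F_{N,R});\delta_n,\eta_{1:n})\le\delta_n^2,$$ and let $\lambda_n\ge 8\delta_n^2/R$. Let $\widehat f$ be any random element of $\mathcal{NN}(N)$ on this probability space (for instance, any function of the noises $\eta_{1:n}$; no measurability is required) such that, almost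 surely, $$\|\widehat f-h\|_n^2+\lambda_n\kappa(\widehat f)\le c_0\big(\|f-h\|_n^2+\lambda_n\kappa(f)\big)+\frac2n\Big|\sum_{i=1}^n\eta_i\big(\widehat f(X_i)-f(X_i)\big)\Big|\qquad\text{for all } f\in\mathcal{NN}(N).$$ Then there is an event of probability at least $1-c_1\exp(-c_2n\delta_n^2/B^2)$ on which $$\|\widehat f-h\|_n^2+\lambda_n\kappa(\widehat f)\le(1+2c_0)\big(\|f-h\|_n^2+\lambda_n\kappa(f)\big)+64\,\delta_n^2\qquad\text{for all } f\in\mathcal F_{N,R}.$$ -/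

import Mathlib

open MeasureTheory ProbabilityTheory

noncomputable section

namespace ShallowNet

/-- The closed Euclidean unit ball of `ℝ^d`. -/
abbrev Ball (d : ℕ) : Type := Metric.closedBall (0 : EuclideanSpace ℝ (Fin d)) 1

/-- The unit sphere of `ℝ^(d+1)`. -/
abbrev Sphere (d : ℕ) : Type := Metric.sphere (0 : EuclideanSpace ℝ (Fin (d + 1))) 1

/-- The ReLU function. -/
def relu (t : ℝ) : ℝ := max t 0

/-- The vector `(x, 1)` of `ℝ^(d+1)`. -/
def augment {d : ℕ} (x : Ball d) : EuclideanSpace ℝ (Fin (d + 1)) :=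
  WithLp.toLp 2 (Fin.snoc (fun i => (x : EuclideanSpace ℝ (Fin d)) i) 1)

/-- The function `x ↦ σ((x, 1) · v)` on the ball. -/
def neuron {d : ℕ} (v : EuclideanSpace ℝ (Fin (d + 1))) (x : Ball d) : ℝ :=
  relu (inner ℝ (augment x) v)

/-- A signed measure on the sphere supported on finitely many points, `∑ c_v δ_v`, represented by
its (finitely supported) family of point masses `v ↦ c_v`. -/
abbrev DiscMeasure (d : ℕ) : Type := Sphere d →₀ ℝ

/-- The total variation norm of `∑ c_v δ_v`, that is `∑ |c_v|`. -/
def DiscMeasure.tv {d : ℕ} (μ : DiscMeasure d) : ℝ := μ.sum fun _ c => |c|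

/-- The function `f_μ(x) = ∫ σ((x, 1) · v) dμ(v)` for a discrete `μ`. -/
def DiscMeasure.toFun {d : ℕ} (μ : DiscMeasure d) (x : Ball d) : ℝ :=
  μ.sum fun v c => c * neuron (v : EuclideanSpace ℝ (Fin (d + 1))) x

/-- `κ(f)`: the infimum of `‖μ‖` over the discrete measures `μ` with `f = f_μ`
(used only for functions that have such a representation). -/
def kappa {d : ℕ} (f : Ball d → ℝ) : ℝ :=
  sInf {r : ℝ | ∃ μ : DiscMeasure d, f = μ.toFun ∧ r = μ.tv}

/-- `NN(N)`: shallow ReLU networks with at most `N` neurons, as functions on the ball. -/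
def NN (d N : ℕ) : Set (Ball d → ℝ) :=
  {f | ∃ (a : Fin N → ℝ) (w : Fin N → EuclideanSpace ℝ (Fin (d + 1))),
    f = fun x => ∑ i, a i * neuron (w i) x}

/-- The networks `f` in `NN(N)` with `κ(f) ≤ R`. -/
def NNR (d N : ℕ) (R : ℝ) : Set (Ball d → ℝ) := {f | f ∈ NN d N ∧ kappa f ≤ R}

/-- The class of differences `f₁ - f₂` of members of `F`. -/
def diffClass {d : ℕ} (F : Set (Ball d → ℝ)) : Set (Ball d → ℝ) :=
  {g | ∃ f₁ ∈ F, ∃ f₂ ∈ F, g = f₁ - f₂}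

/-- The star hull of `F`. -/
def starHull {d : ℕ} (F : Set (Ball d → ℝ)) : Set (Ball d → ℝ) :=
  {g | ∃ f ∈ F, ∃ a ∈ Set.Icc (0 : ℝ) 1, g = a • f}

/-- The `L²` norm for the empirical distribution of the points `X`. -/
def empNorm {d n : ℕ} (X : Fin n → Ball d) (f : Ball d → ℝ) : ℝ :=
  √((1 / (n : ℝ)) * ∑ i, f (X i) ^ 2)

/-- The local complexity of the class `F` at scale `δ` with respect to the random variables `ξ`:
the expectation of the supremum of `|(1/n) ∑ ξ_i f(X_i)|` over the `f ∈ F` with empirical norm at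
most `δ`. By Cauchy-Schwarz this supremum is over a bounded set. -/
def localComplexity {d n : ℕ} {Ω : Type*} [MeasurableSpace Ω] (P : Measure Ω)
    (X : Fin n → Ball d) (F : Set (Ball d → ℝ)) (δ : ℝ) (ξ : Fin n → Ω → ℝ) : ℝ :=
  ∫ ω, (⨆ f : {f : Ball d → ℝ // f ∈ F ∧ empNorm X f ≤ δ},
    |(1 / (n : ℝ)) * ∑ i, ξ i ω * f.1 (X i)|) ∂P

end ShallowNet

end

namespace ShallowNet

/-! ### Integrability of continuous functions for compactly supported measures -/

/-! Write Z for the localized supremum over the star hull of the difference class, as a function of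
the noise vector. Z is a supremum of absolute values of linear forms, hence convex, and by
Cauchy-Schwarz it is Lipschitz in the Euclidean norm with constant `δ / √n`. Its mean is at most `δ
^ 2` by assumption, so concentration of convex Lipschitz functions of independent bounded variables
gives `Z ≤ 2 * δ ^ 2` outside an event of exponentially small probability.

The concentration comes from Maurey's property (τ) for convex functions: a one-variable inequality
(`integral_exp_mul_integral_exp_neg_le_one`), tensorized in `maurey_pi`, then Jensen and Chernoff.

On the good event the rest is deterministic (`oracle_bound_of_localSup_le`). The estimator may have
variation norm above `R`, so both networks are shrunk by a common factor into the class. Undoing the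
shrinkage costs a term proportional to `δ ^ 2 * kappa fhat / R`, and `lam` is large enough for half
of the penalty to absorb it. The event depends on the noise only, so the bound holds for all
comparison functions at once. -/

theorem integrable_of_ae_mem_compact {E : Type*} [TopologicalSpace E] [MeasurableSpace E]
    [OpensMeasurableSpace E] [T2Space E] [SecondCountableTopology E] {μ : Measure E}
    [IsFiniteMeasure μ] {K : Set E} (hK : IsCompact K) (hμ : ∀ᵐ x ∂μ, x ∈ K) {g : E → ℝ} (hg : Continuous g) :
    Integrable g μ := by
  have h := hg.continuousOn.integrableOn_compact (μ := μ) hK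
  rwa [IntegrableOn, Measure.restrict_eq_self_of_ae_mem hμ] at h

/-! ### The one-dimensional inequality -/

/-- Factoring out `exp (-u²/2)` leaves `2 cosh (u - u²/2)`, and `cosh z ≤ exp (z²/2)` suffices
because `|u - u²/2| ≤ u` on the unit interval. -/
theorem exp_sub_sq_add_exp_neg_le_two {u : ℝ} (h0 : 0 ≤ u) (h1 : u ≤ 1) :
    Real.exp (u - u ^ 2) + Real.exp (-u) ≤ 2 := by
  have h := Real.cosh_le_exp_half_sq (u - u ^ 2 / 2)
  have e : Real.exp (u - u ^ 2) + Real.exp (-u)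
      = 2 * (Real.exp (-(u ^ 2 / 2)) * Real.cosh (u - u ^ 2 / 2)) := by
    rw [Real.cosh_eq]
    have a1 : Real.exp (u - u ^ 2) = Real.exp (-(u ^ 2 / 2)) * Real.exp (u - u ^ 2 / 2) := by
      rw [← Real.exp_add]; congr 1; ring
    have a2 : Real.exp (-u) = Real.exp (-(u ^ 2 / 2)) * Real.exp (-(u - u ^ 2 / 2)) := by
      rw [← Real.exp_add]; congr 1; ring
    rw [a1, a2]; ring
  have h2 : Real.exp (-(u ^ 2 / 2)) * Real.cosh (u - u ^ 2 / 2) ≤ 1 := by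
    calc _ ≤ Real.exp (-(u ^ 2 / 2)) * Real.exp ((u - u ^ 2 / 2) ^ 2 / 2) := by gcongr
      _ = Real.exp (-(u ^ 2 / 2) + (u - u ^ 2 / 2) ^ 2 / 2) := by rw [Real.exp_add]
      _ ≤ 1 := by
        rw [Real.exp_le_one_iff]
        have : (u - u ^ 2 / 2) ^ 2 ≤ u ^ 2 := by
          apply pow_le_pow_left₀ <;> nlinarith
        linarith
  linarith

theorem exp_infConv_add_exp_neg_le_two {u v : ℝ} (hu : 0 ≤ u)
    (hv : ∀ θ ∈ Set.Icc (0 : ℝ) 1, v ≤ (1 - θ) * u + θ ^ 2 / 4) :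
    Real.exp v + Real.exp (-u) ≤ 2 := by
  -- The bound on `v` is minimized at `θ = 2u` when this is at most 1, with value `u - u²`.
  -- Otherwise `θ = 1` gives `1/4`, the value of `u - u²` at `u = 1/2`.
  rcases le_total u (1 / 2) with h | h
  · have h1 := hv (2 * u) ⟨by linarith, by linarith⟩
    have h2 : Real.exp v ≤ Real.exp (u - u ^ 2) := Real.exp_le_exp.2 (by nlinarith)
    linarith [exp_sub_sq_add_exp_neg_le_two hu (by linarith)]
  · have h1 := hv 1 ⟨by norm_num, by norm_num⟩
    have h2 : Real.exp v ≤ Real.exp (1 / 2 - (1 / 2) ^ 2) := Real.exp_le_exp.2 (by linarith)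
    have h3 : Real.exp (-u) ≤ Real.exp (-(1 / 2)) := Real.exp_le_exp.2 (by linarith)
    linarith [exp_sub_sq_add_exp_neg_le_two (u := 1 / 2) (by norm_num) (by norm_num)]

/-- Maurey's inequality for a convex function of one bounded variable. -/
theorem integral_exp_mul_integral_exp_neg_le_one {ν : Measure ℝ} [IsProbabilityMeasure ν]
    {a b D : ℝ} (hD : 0 < D) (hab : b - a ≤ D) (hν : ∀ᵐ t ∂ν, t ∈ Set.Icc a b)
    {f q : ℝ → ℝ} (hf : ConvexOn ℝ Set.univ f) (hfc : Continuous f) (hqc : Continuous q)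
    (hq : ∀ x y, q x ≤ f y + (x - y) ^ 2 / (4 * D ^ 2)) :
    (∫ t, Real.exp (q t) ∂ν) * (∫ t, Real.exp (-f t) ∂ν) ≤ 1 := by
  have hne : (Set.Icc a b).Nonempty := by
    obtain ⟨t, ht⟩ := hν.exists
    exact ⟨t, ht⟩
  obtain ⟨x₀, hx₀, hmin⟩ := isCompact_Icc.exists_isMinOn hne hfc.continuousOn
  have key : ∀ t ∈ Set.Icc a b,
      Real.exp (q t - f x₀) + Real.exp (-(f t - f x₀)) ≤ 2 := by
    intro t ht
    -- Test the bound on `q` at points moved from `t` towards the minimizer of `f`: convexity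
    -- controls `f` there, and the cost is at most `θ² / 4` as the interval has length at most `D`.
    refine exp_infConv_add_exp_neg_le_two (sub_nonneg.2 (hmin ht)) fun θ hθ => ?_
    have h1 := hq t ((1 - θ) * t + θ * x₀)
    have h2 := hf.2 (Set.mem_univ t) (Set.mem_univ x₀) (sub_nonneg.2 hθ.2) hθ.1 (by ring)
    simp only [smul_eq_mul] at h2
    have h3 : (t - ((1 - θ) * t + θ * x₀)) ^ 2 / (4 * D ^ 2) ≤ θ ^ 2 / 4 := by
      have h4 : (t - x₀) ^ 2 ≤ D ^ 2 := by
        rw [sq_le_sq, abs_of_pos hD, abs_le]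
        constructor <;> linarith [ht.1, ht.2, hx₀.1, hx₀.2]
      rw [div_le_div_iff₀ (by positivity) (by norm_num)]
      nlinarith [mul_le_mul_of_nonneg_left h4 (sq_nonneg θ)]
    linarith
  have i1 : Integrable (fun t => Real.exp (q t - f x₀)) ν :=
    integrable_of_ae_mem_compact isCompact_Icc hν (by fun_prop)
  have i2 : Integrable (fun t => Real.exp (-(f t - f x₀))) ν :=
    integrable_of_ae_mem_compact isCompact_Icc hν (by fun_prop)
  have hsum : (∫ t, Real.exp (q t - f x₀) ∂ν) + ∫ t, Real.exp (-(f t - f x₀)) ∂ν ≤ 2 := by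
    rw [← integral_add i1 i2]
    calc _ ≤ ∫ _, (2 : ℝ) ∂ν :=
          integral_mono_ae (i1.add i2) (integrable_const _) (by
            filter_upwards [hν] with t ht using key t ht)
      _ = 2 := by simp
  have e1 : ∫ t, Real.exp (q t - f x₀) ∂ν = (∫ t, Real.exp (q t) ∂ν) * Real.exp (-f x₀) := by
    rw [← integral_mul_const]; congr 1; ext t; rw [← Real.exp_add]; rfl
  have e2 : ∫ t, Real.exp (-(f t - f x₀)) ∂ν = (∫ t, Real.exp (-f t) ∂ν) * Real.exp (f x₀) := by
    rw [← integral_mul_const]; congr 1; ext t; rw [← Real.exp_add]; congr 1; ring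
  have e3 : Real.exp (-f x₀) * Real.exp (f x₀) = 1 := by rw [← Real.exp_add]; simp
  have e4 : (∫ t, Real.exp (q t) ∂ν) * (∫ t, Real.exp (-f t) ∂ν)
      = (∫ t, Real.exp (q t - f x₀) ∂ν) * ∫ t, Real.exp (-(f t - f x₀)) ∂ν := by
    rw [e1, e2]
    linear_combination (-(∫ t, Real.exp (q t) ∂ν) * (∫ t, Real.exp (-f t) ∂ν)) * e3
  rw [e4]
  have p1 : 0 ≤ ∫ t, Real.exp (q t - f x₀) ∂ν := integral_nonneg fun t => (Real.exp_pos _).le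
  have p2 : 0 ≤ ∫ t, Real.exp (-(f t - f x₀)) ∂ν := integral_nonneg fun t => (Real.exp_pos _).le
  -- Two nonnegative numbers with sum at most 2 have product at most 1.
  nlinarith [sq_nonneg ((∫ t, Real.exp (q t - f x₀) ∂ν) - ∫ t, Real.exp (-(f t - f x₀)) ∂ν)]

/-! ### Partial infimal convolution and partial log-integral-exp -/

section Partial

variable {E : Type*} [NormedAddCommGroup E] [NormedSpace ℝ E]

/-- Infimal convolution of `f` with the quadratic cost `u² / C` in the first variable. -/
noncomputable def partialInfConv (C : ℝ) (f : ℝ × E → ℝ) (p : ℝ × E) : ℝ :=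
  ⨅ u : ℝ, f (p.1 + u, p.2) + u ^ 2 / C

/-- `log ∫ exp f(t, ·) dν(t)`. -/
noncomputable def logIntExp (ν : Measure ℝ) (f : ℝ × E → ℝ) (y : E) : ℝ :=
  Real.log (∫ t, Real.exp (f (t, y)) ∂ν)

variable {C : ℝ} {K : NNReal} {f g : ℝ × E → ℝ}

omit [NormedSpace ℝ E] in
theorem partialInfConv_bddBelow (hC : 0 < C) (hf : LipschitzWith K f) (p : ℝ × E) :
    BddBelow (Set.range fun u : ℝ => f (p.1 + u, p.2) + u ^ 2 / C) := by
  refine ⟨f p - K ^ 2 * C, ?_⟩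
  rintro _ ⟨u, rfl⟩
  have h := hf.le_add_mul p (p.1 + u, p.2)
  have hd : dist p (p.1 + u, p.2) = |u| := by simp [Prod.dist_eq]
  rw [hd] at h
  have : K * |u| ≤ K ^ 2 * C + u ^ 2 / C := by
    have h1 : u ^ 2 / C * C = u ^ 2 := by field_simp
    have h2 : 0 ≤ u ^ 2 / C := by positivity
    have h3 : (K * |u|) ^ 2 = (K ^ 2 * C) * (u ^ 2 / C) := by
      rw [mul_pow, sq_abs]; field_simp
    have h4 : (0 : ℝ) ≤ K ^ 2 * C := by positivity
    refine abs_le_of_sq_le_sq' ?_ (by positivity) |>.2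
    nlinarith [mul_nonneg h4 h2]
  simp only
  linarith

omit [NormedSpace ℝ E] in
theorem partialInfConv_le (hC : 0 < C) (hf : LipschitzWith K f) (t s : ℝ) (y : E) :
    partialInfConv C f (t, y) ≤ f (s, y) + (t - s) ^ 2 / C := by
  have h := ciInf_le (partialInfConv_bddBelow hC hf (t, y)) (s - t)
  simp only [add_sub_cancel] at h
  rwa [← neg_sub s t, neg_sq]

omit [NormedSpace ℝ E] in
theorem partialInfConv_lipschitz (hC : 0 < C) (hf : LipschitzWith K f) :
    LipschitzWith K (partialInfConv C f) := by
  refine LipschitzWith.of_le_add_mul K fun p p' => ?_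
  rw [← sub_le_iff_le_add]
  refine le_ciInf fun u => ?_
  have h := ciInf_le (partialInfConv_bddBelow hC hf p) u
  have h2 := hf.le_add_mul (p.1 + u, p.2) (p'.1 + u, p'.2)
  have hd : dist (p.1 + u, p.2) (p'.1 + u, p'.2) = dist p p' := by simp [Prod.dist_eq]
  rw [hd] at h2
  unfold partialInfConv
  linarith

theorem partialInfConv_convex (hC : 0 < C) (hf : LipschitzWith K f)
    (hfc : ConvexOn ℝ Set.univ f) : ConvexOn ℝ Set.univ (partialInfConv C f) := by
  refine ⟨convex_univ, fun p _ p' _ a b ha hb hab => ?_⟩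
  have key : ∀ u v : ℝ, partialInfConv C f (a • p + b • p') ≤
      a * (f (p.1 + u, p.2) + u ^ 2 / C) + b * (f (p'.1 + v, p'.2) + v ^ 2 / C) := by
    intro u v
    have h := ciInf_le (partialInfConv_bddBelow hC hf (a • p + b • p')) (a * u + b * v)
    have h2 := hfc.2 (Set.mem_univ (p.1 + u, p.2)) (Set.mem_univ (p'.1 + v, p'.2)) ha hb hab
    have e : a • (p.1 + u, p.2) + b • (p'.1 + v, p'.2) =
        ((a • p + b • p').1 + (a * u + b * v), (a • p + b • p').2) := by
      ext <;> simp; ring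
    rw [e] at h2
    have h3 : (a * u + b * v) ^ 2 / C ≤ a * (u ^ 2 / C) + b * (v ^ 2 / C) := by
      rw [← mul_div_assoc, ← mul_div_assoc, ← add_div]
      gcongr
      have hb' : b = 1 - a := by linarith
      subst hb'
      nlinarith [mul_nonneg (mul_nonneg ha hb) (sq_nonneg (u - v))]
    simp only [smul_eq_mul] at h2
    unfold partialInfConv
    linarith
  -- The two infima are taken one after the other, so no minimizers are needed.
  have h1 : ∀ v : ℝ, partialInfConv C f (a • p + b • p') -
      b * (f (p'.1 + v, p'.2) + v ^ 2 / C) ≤ a * partialInfConv C f p := by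
    intro v
    unfold partialInfConv
    rw [Real.mul_iInf_of_nonneg ha]
    exact le_ciInf fun u => by have := key u v; unfold partialInfConv at this; linarith
  have h2 : partialInfConv C f (a • p + b • p') - a * partialInfConv C f p ≤
      b * partialInfConv C f p' := by
    conv_rhs => unfold partialInfConv
    rw [Real.mul_iInf_of_nonneg hb]
    exact le_ciInf fun v => by have := h1 v; linarith
  simp only [smul_eq_mul]
  linarith

variable {ν : Measure ℝ} [IsProbabilityMeasure ν] {a b : ℝ}

omit [NormedSpace ℝ E] in
theorem integrable_exp_slice (hν : ∀ᵐ t ∂ν, t ∈ Set.Icc a b) (hf : Continuous f) (y : E) :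
    Integrable (fun t => Real.exp (f (t, y))) ν :=
  integrable_of_ae_mem_compact isCompact_Icc hν (by fun_prop)

omit [NormedSpace ℝ E] in
theorem exp_logIntExp (hν : ∀ᵐ t ∂ν, t ∈ Set.Icc a b) (hf : Continuous f) (y : E) :
    Real.exp (logIntExp ν f y) = ∫ t, Real.exp (f (t, y)) ∂ν :=
  Real.exp_log (integral_exp_pos (integrable_exp_slice hν hf y))

omit [NormedSpace ℝ E] in
theorem logIntExp_le (hν : ∀ᵐ t ∂ν, t ∈ Set.Icc a b) (hf : Continuous f) (hg : Continuous g)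
    {x y : E} {r : ℝ} (h : ∀ t, f (t, x) ≤ g (t, y) + r) :
    logIntExp ν f x ≤ logIntExp ν g y + r := by
  rw [← Real.exp_le_exp, Real.exp_add, exp_logIntExp hν hf, exp_logIntExp hν hg,
    ← integral_mul_const]
  refine integral_mono (integrable_exp_slice hν hf x)
    ((integrable_exp_slice hν hg y).mul_const _) fun t => ?_
  simp only
  rw [← Real.exp_add]
  exact Real.exp_le_exp.2 (h t)

omit [NormedSpace ℝ E] in
theorem logIntExp_lipschitz (hν : ∀ᵐ t ∂ν, t ∈ Set.Icc a b) (hf : LipschitzWith K f) :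
    LipschitzWith K (logIntExp ν f) := by
  refine LipschitzWith.of_le_add_mul K fun x y =>
    logIntExp_le hν hf.continuous hf.continuous fun t => ?_
  have h := hf.le_add_mul (t, x) (t, y)
  have hd : dist (t, x) (t, y) = dist x y := by simp [Prod.dist_eq]
  rwa [hd] at h

/-- Once `exp f(·, x)` and `exp f(·, y)` are normalized to integral 1, convexity of `exp` bounds the
integral at the convex combination by 1. This replaces Hölder's inequality. -/
theorem logIntExp_convex (hν : ∀ᵐ t ∂ν, t ∈ Set.Icc a b) (hf : Continuous f)
    (hfc : ConvexOn ℝ Set.univ f) : ConvexOn ℝ Set.univ (logIntExp ν f) := by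
  refine ⟨convex_univ, fun x _ y _ α β hα hβ hαβ => ?_⟩
  simp only [smul_eq_mul]
  set A := logIntExp ν f x with hA
  set B := logIntExp ν f y with hB
  have one : ∀ z, ∫ t, Real.exp (f (t, z) - logIntExp ν f z) ∂ν = 1 := by
    intro z
    have : ∀ t, Real.exp (f (t, z) - logIntExp ν f z) =
        Real.exp (f (t, z)) * Real.exp (-logIntExp ν f z) := fun t => by
      rw [← Real.exp_add]; rfl
    simp_rw [this]
    rw [integral_mul_const, ← exp_logIntExp hν hf, ← Real.exp_add]
    simp
  have int : ∀ z (r : ℝ), Integrable (fun t => Real.exp (f (t, z) - r)) ν := fun z r =>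
    integrable_of_ae_mem_compact isCompact_Icc hν (by fun_prop)
  have h : ∫ t, Real.exp (f (t, α • x + β • y) - (α * A + β * B)) ∂ν ≤ 1 := by
    calc _ ≤ ∫ t, (α * Real.exp (f (t, x) - A) + β * Real.exp (f (t, y) - B)) ∂ν := by
          refine integral_mono (int _ _) (((int _ _).const_mul _).add ((int _ _).const_mul _))
            fun t => ?_
          have h1 := hfc.2 (Set.mem_univ (t, x)) (Set.mem_univ (t, y)) hα hβ hαβ
          have e : α • (t, x) + β • (t, y) = (t, α • x + β • y) := by
            ext
            · simp [← add_mul, hαβ]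
            · simp
          rw [e] at h1
          have h2 := convexOn_exp.2 (Set.mem_univ (f (t, x) - A)) (Set.mem_univ (f (t, y) - B))
            hα hβ hαβ
          simp only [smul_eq_mul] at h1 h2
          refine le_trans (Real.exp_le_exp.2 ?_) h2
          linarith
      _ = 1 := by
          rw [integral_add ((int _ _).const_mul _) ((int _ _).const_mul _), integral_const_mul,
            integral_const_mul, one, one]
          linarith
  have e : ∫ t, Real.exp (f (t, α • x + β • y) - (α * A + β * B)) ∂ν =
      Real.exp (logIntExp ν f (α • x + β • y) - (α * A + β * B)) := by
    rw [sub_eq_add_neg, Real.exp_add, exp_logIntExp hν hf, ← integral_mul_const]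
    congr 1; ext t; rw [← Real.exp_add]; rfl
  rw [e, Real.exp_le_one_iff] at h
  linarith

end Partial

/-! ### Tensorization -/

/-- Maurey's property (τ) for convex functions. -/
theorem maurey_pi {D : ℝ} (hD : 0 < D) {a b : ℝ} (hab : b - a ≤ D) (n : ℕ)
    (μ : Fin n → Measure ℝ) [∀ i, IsProbabilityMeasure (μ i)]
    (hμ : ∀ i, ∀ᵐ t ∂μ i, t ∈ Set.Icc a b) (f F : (Fin n → ℝ) → ℝ)
    (hfc : ConvexOn ℝ Set.univ f) {K K' : NNReal} (hf : LipschitzWith K f)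
    (hF : LipschitzWith K' F)
    (hFf : ∀ x y, F x ≤ f y + (∑ i, (x i - y i) ^ 2) / (4 * D ^ 2)) :
    (∫ x, Real.exp (F x) ∂Measure.pi μ) * (∫ x, Real.exp (-f x) ∂Measure.pi μ) ≤ 1 := by
  induction n with
  | zero =>
    rw [Measure.pi_of_empty μ (fun i => i.elim0), integral_dirac, integral_dirac, ← Real.exp_add,
      Real.exp_le_one_iff]
    have := hFf (fun i => i.elim0) (fun i => i.elim0)
    simp at this
    linarith
  | succ n ih =>
    set π := Measure.pi fun i => μ (Fin.succ i) 
    have mp := (measurePreserving_piFinSuccAbove μ 0).symm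
    have hc : ∀ p : ℝ × (Fin n → ℝ), (MeasurableEquiv.piFinSuccAbove (fun _ => ℝ) 0).symm p =
        Fin.cons p.1 p.2 := by
      intro p
      simp [MeasurableEquiv.piFinSuccAbove, Fin.insertNthEquiv]
    have tr : ∀ g : (Fin (n + 1) → ℝ) → ℝ, ∫ x, g x ∂Measure.pi μ =
        ∫ p : ℝ × (Fin n → ℝ), g (Fin.cons p.1 p.2) ∂(μ 0).prod π := by
      intro g
      rw [← mp.integral_comp (MeasurableEquiv.measurableEmbedding _)]
      simp_rw [hc]
      rfl
    set c : ℝ × (Fin n → ℝ) → (Fin (n + 1) → ℝ) := fun p => Fin.cons p.1 p.2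
    have cl : LipschitzWith 1 c := by
      refine LipschitzWith.of_dist_le_mul fun p p' => ?_
      rw [NNReal.coe_one, one_mul, dist_pi_le_iff dist_nonneg]
      intro i
      refine Fin.cases ?_ (fun j => ?_) i
      · simp [c, Prod.dist_eq]
      · simp only [c, Fin.cons_succ, Prod.dist_eq]
        exact le_max_of_le_right (dist_le_pi_dist p.2 p'.2 j)
    have hf1 : LipschitzWith K (f ∘ c) := by simpa using hf.comp cl
    have hF1 : LipschitzWith K' (F ∘ c) := by simpa using hF.comp cl
    have hfc1 : ConvexOn ℝ Set.univ (f ∘ c) := by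
      refine ⟨convex_univ, fun p _ p' _ α β hα hβ hαβ => ?_⟩
      have e : c (α • p + β • p') = α • c p + β • c p' := by
        ext i
        refine Fin.cases ?_ (fun j => ?_) i <;> simp [c]
      simp only [Function.comp_apply, e]
      exact hfc.2 (Set.mem_univ _) (Set.mem_univ _) hα hβ hαβ
    have hC : 0 < 4 * D ^ 2 := by positivity
    -- Integrating out the first coordinate replaces `f` by `logIntExp` of `q` and `F` by its own
    -- `logIntExp`. Joint convexity of `q` makes the new function convex, so the induction
    -- hypothesis applies; the one-variable inequality on each slice compares the integrals of `exp
    -- (-f)`.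
    set q := partialInfConv (4 * D ^ 2) (f ∘ c)
    have ql : LipschitzWith K q := partialInfConv_lipschitz hC hf1
    have qc : ConvexOn ℝ Set.univ q := partialInfConv_convex hC hf1 hfc1
    have hK : IsCompact (Set.Icc (fun _ : Fin n => a) fun _ => b) := isCompact_Icc
    have hπK : ∀ᵐ x ∂π, x ∈ Set.Icc (fun _ : Fin n => a) fun _ => b := by
      have : ∀ᵐ x ∂π, ∀ i, x i ∈ Set.Icc a b :=
        ae_all_iff.2 fun i => (Measure.tendsto_eval_ae_ae (i := i)).eventually (hμ i.succ)
      filter_upwards [this] with x hx using ⟨fun i => (hx i).1, fun i => (hx i).2⟩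
    have hprod : ∀ᵐ p ∂(μ 0).prod π,
        p ∈ Set.Icc a b ×ˢ Set.Icc (fun _ : Fin n => a) fun _ => b := by
      have h1 := Measure.quasiMeasurePreserving_fst (μ := μ 0) (ν := π) |>.ae (hμ 0)
      have h2 := Measure.quasiMeasurePreserving_snd (μ := μ 0) (ν := π) |>.ae hπK
      filter_upwards [h1, h2] with p hp1 hp2 using ⟨hp1, hp2⟩
    have int : ∀ g : ℝ × (Fin n → ℝ) → ℝ, Continuous g → Integrable g ((μ 0).prod π) :=
      fun g hg => integrable_of_ae_mem_compact (isCompact_Icc.prod hK) hprod hg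
    have step := ih (fun i => μ i.succ) (fun i => hμ i.succ) (logIntExp (μ 0) q)
      (logIntExp (μ 0) (F ∘ c)) (logIntExp_convex (hμ 0) ql.continuous qc)
      (logIntExp_lipschitz (hμ 0) ql) (logIntExp_lipschitz (hμ 0) hF1) (by
        intro x y
        refine logIntExp_le (hμ 0) hF1.continuous ql.continuous fun t => ?_
        rw [← sub_le_iff_le_add]
        refine le_ciInf fun u => ?_
        have h := hFf (c (t, x)) (c (t + u, y))
        rw [Fin.sum_univ_succ, add_div] at h
        simp only [c, Fin.cons_zero, Fin.cons_succ, sub_add_cancel_left, neg_sq] at h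
        simp only [Function.comp_apply, c]
        linarith)
    have e1 : ∫ x, Real.exp (F x) ∂Measure.pi μ =
        ∫ x, Real.exp (logIntExp (μ 0) (F ∘ c) x) ∂π := by
      have hFc := hF1.continuous
      have i0 := int (fun p => Real.exp ((F ∘ c) p)) (Real.continuous_exp.comp hFc)
      rw [tr]
      refine (integral_prod_symm _ i0).trans ?_
      simp_rw [exp_logIntExp (hμ 0) hF1.continuous]
    have e2 : ∫ x, Real.exp (-f x) ∂Measure.pi μ ≤
        ∫ x, Real.exp (-logIntExp (μ 0) q x) ∂π := by
      have hfc' := hf1.continuous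
      have i0 := int (fun p => Real.exp (-(f ∘ c) p)) (Real.continuous_exp.comp hfc'.neg)
      rw [tr]
      refine (integral_prod_symm _ i0).trans_le ?_
      refine integral_mono i0.integral_prod_right
        (integrable_of_ae_mem_compact hK hπK
          (Real.continuous_exp.comp (logIntExp_lipschitz (hμ 0) ql).continuous.neg)) fun y => ?_
      have qcont := ql.continuous
      have h1 := integral_exp_mul_integral_exp_neg_le_one hD hab (hμ 0)
        (f := fun t => (f ∘ c) (t, y)) (q := fun t => q (t, y))
        ⟨convex_univ, fun s _ t _ α β hα hβ hαβ => by
          have h := hfc1.2 (Set.mem_univ (s, y)) (Set.mem_univ (t, y)) hα hβ hαβ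
          have e : α • (s, y) + β • (t, y) = (α • s + β • t, y) := by
            rw [Prod.smul_mk, Prod.smul_mk, Prod.mk_add_mk, ← add_smul, hαβ, one_smul]
          rwa [e] at h⟩
        (hfc'.comp (by fun_prop)) (by fun_prop) (fun s t => partialInfConv_le hC hf1 s t y)
      rw [← exp_logIntExp (hμ 0) ql.continuous] at h1
      simp only
      rw [Real.exp_neg, ← one_div, le_div_iff₀' (Real.exp_pos _)]
      exact h1
    rw [e1]
    exact le_trans (mul_le_mul_of_nonneg_left e2
      (integral_nonneg fun x => (Real.exp_pos _).le)) step

/-! ### Upper tails of convex Lipschitz functions -/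

/-- The sup-norm constant depends on the dimension, but it serves only continuity and integrability
and enters no tail bound. -/
theorem lipschitzWith_of_l2 {n : ℕ} {L : ℝ} (hL : 0 ≤ L) {f : (Fin n → ℝ) → ℝ}
    (hf : ∀ x y, f x ≤ f y + L * √(∑ i, (x i - y i) ^ 2)) :
    LipschitzWith (Real.toNNReal (L * √n)) f := by
  refine LipschitzWith.of_le_add_mul _ fun x y => (hf x y).trans ?_
  have : √(∑ i, (x i - y i) ^ 2) ≤ √n * dist x y := by
    refine Real.sqrt_le_iff.2 ⟨by positivity, ?_⟩
    rw [mul_pow, Real.sq_sqrt (by positivity)]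
    calc ∑ i, (x i - y i) ^ 2 ≤ ∑ _i : Fin n, dist x y ^ 2 := by
          refine Finset.sum_le_sum fun i _ => ?_
          rw [← sq_abs, ← Real.dist_eq]
          exact pow_le_pow_left₀ dist_nonneg (dist_le_pi_dist x y i) 2
      _ = n * dist x y ^ 2 := by simp
  have := mul_le_mul_of_nonneg_left this hL
  rw [Real.coe_toNNReal _ (by positivity)]
  linarith

theorem integral_exp_convex_le {D : ℝ} (hD : 0 < D) {a b : ℝ} (hab : b - a ≤ D) {n : ℕ}
    (μ : Fin n → Measure ℝ) [∀ i, IsProbabilityMeasure (μ i)]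
    (hμ : ∀ i, ∀ᵐ t ∂μ i, t ∈ Set.Icc a b) {f : (Fin n → ℝ) → ℝ}
    (hfc : ConvexOn ℝ Set.univ f) {L : ℝ} (hL : 0 ≤ L)
    (hf : ∀ x y, f x ≤ f y + L * √(∑ i, (x i - y i) ^ 2)) {s : ℝ} (hs : 0 ≤ s) :
    ∫ x, Real.exp (s * f x) ∂Measure.pi μ ≤
      Real.exp (s * (∫ x, f x ∂Measure.pi μ) + s ^ 2 * L ^ 2 * D ^ 2) := by
  have lip := lipschitzWith_of_l2 hL hf
  have hcont := lip.continuous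
  have hsf : ∀ x y, s * f x ≤ s * f y + (s * L) * √(∑ i, (x i - y i) ^ 2) := fun x y => by
    nlinarith [mul_le_mul_of_nonneg_left (hf x y) hs]
  have lips := lipschitzWith_of_l2 (mul_nonneg hs hL) hsf
  have hπK : ∀ᵐ x ∂Measure.pi μ, x ∈ Set.Icc (fun _ : Fin n => a) fun _ => b := by
    have : ∀ᵐ x ∂Measure.pi μ, ∀ i, x i ∈ Set.Icc a b :=
      ae_all_iff.2 fun i => (Measure.tendsto_eval_ae_ae (i := i)).eventually (hμ i)
    filter_upwards [this] with x hx using ⟨fun i => (hx i).1, fun i => (hx i).2⟩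
  have int : ∀ g : (Fin n → ℝ) → ℝ, Continuous g → Integrable g (Measure.pi μ) :=
    fun g hg => integrable_of_ae_mem_compact isCompact_Icc hπK hg
  -- Since `s L r ≤ s² L² D² + r² / (4 D²)`, lowering `s f` by `s² L² D²` puts it below the infimal
  -- convolution, which itself never has to be studied.
  have h := maurey_pi hD hab n μ hμ (fun x => s * f x)
    (fun x => s * f x - s ^ 2 * L ^ 2 * D ^ 2) (hfc.smul hs) lips
    (LipschitzWith.of_le_add_mul (Real.toNNReal (s * L * √n)) fun x y => by have := lips.le_add_mul x y; linarith)
    (fun x y => by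
      have h1 := hsf x y
      set r := √(∑ i, (x i - y i) ^ 2)
      have h2 : r ^ 2 = ∑ i, (x i - y i) ^ 2 := Real.sq_sqrt (by positivity)
      rw [← h2]
      have h3 : r ^ 2 / (4 * D ^ 2) = (r / (2 * D)) ^ 2 := by rw [div_pow]; ring
      have h4 : s * L * r = 2 * (s * L * D) * (r / (2 * D)) := by field_simp
      rw [h3]
      nlinarith [sq_nonneg (s * L * D - r / (2 * D))])
  have jensen : Real.exp (-(s * ∫ x, f x ∂Measure.pi μ)) ≤
      ∫ x, Real.exp (-(s * f x)) ∂Measure.pi μ := by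
    have hj := convexOn_exp.map_integral_le (μ := Measure.pi μ) (f := fun x => -(s * f x))
      Real.continuous_exp.continuousOn isClosed_univ (by simp) (int _ (by fun_prop))
      (int _ (by fun_prop))
    rw [integral_neg, integral_const_mul] at hj
    exact hj
  have e : ∫ x, Real.exp (s * f x - s ^ 2 * L ^ 2 * D ^ 2) ∂Measure.pi μ =
      (∫ x, Real.exp (s * f x) ∂Measure.pi μ) * Real.exp (-(s ^ 2 * L ^ 2 * D ^ 2)) := by
    rw [← integral_mul_const]; congr 1; ext x; rw [← Real.exp_add]; rfl
  rw [e] at h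
  have hI : 0 ≤ ∫ x, Real.exp (s * f x) ∂Measure.pi μ :=
    integral_nonneg fun x => (Real.exp_pos _).le
  have h' := (mul_le_mul_of_nonneg_left jensen (by positivity :
    0 ≤ (∫ x, Real.exp (s * f x) ∂Measure.pi μ) * Real.exp (-(s ^ 2 * L ^ 2 * D ^ 2)))).trans h
  rw [mul_assoc, ← Real.exp_add, ← le_div_iff₀ (Real.exp_pos _), one_div, ← Real.exp_neg] at h'
  refine h'.trans (Real.exp_le_exp.2 (by linarith))

/-- Upper tail of a convex Lipschitz function of independent bounded random variables. -/
theorem measure_convex_ge_le {D : ℝ} (hD : 0 < D) {a b : ℝ} (hab : b - a ≤ D) {n : ℕ}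
    {Ω : Type*} [MeasurableSpace Ω] (P : Measure Ω) [IsProbabilityMeasure P]
    {η : Fin n → Ω → ℝ} (hm : ∀ i, Measurable (η i)) (hi : iIndepFun η P)
    (hη : ∀ i, ∀ᵐ ω ∂P, η i ω ∈ Set.Icc a b) {f : (Fin n → ℝ) → ℝ}
    (hfc : ConvexOn ℝ Set.univ f) {L : ℝ} (hL : 0 < L)
    (hf : ∀ x y, f x ≤ f y + L * √(∑ i, (x i - y i) ^ 2)) {t : ℝ} (ht : 0 ≤ t) :
    P.real {ω | (∫ ω, f (fun i => η i ω) ∂P) + t ≤ f fun i => η i ω} ≤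
      Real.exp (-(t ^ 2 / (4 * L ^ 2 * D ^ 2))) := by
  have : ∀ i, IsProbabilityMeasure (P.map (η i)) := fun i =>
    Measure.isProbabilityMeasure_map (hm i).aemeasurable
  have hmap := (iIndepFun_iff_map_fun_eq_pi_map fun i => (hm i).aemeasurable).1 hi
  have hμ : ∀ i, ∀ᵐ t ∂P.map (η i), t ∈ Set.Icc a b := fun i =>
    (ae_map_iff (hm i).aemeasurable measurableSet_Icc).2 (hη i)
  have hmv : Measurable fun ω i => η i ω := measurable_pi_lambda _ hm
  have hcont := (lipschitzWith_of_l2 hL.le hf).continuous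
  -- The minimizer of the Chernoff exponent `-s t + s² L² D²`.
  set s := t / (2 * L ^ 2 * D ^ 2) with hs
  have hs0 : 0 ≤ s := by positivity
  have h := integral_exp_convex_le hD hab (fun i => P.map (η i)) hμ hfc hL.le hf hs0
  rw [← hmap, integral_map hmv.aemeasurable (by fun_prop),
    integral_map hmv.aemeasurable (by fun_prop)] at h
  set m := ∫ ω, f (fun i => η i ω) ∂P
  have hint : Integrable (fun ω => Real.exp (s * f fun i => η i ω)) P := by
    have hK : ∀ᵐ x ∂P.map (fun ω i => η i ω), x ∈ Set.Icc (fun _ : Fin n => a) fun _ => b := by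
      refine (ae_map_iff hmv.aemeasurable isClosed_Icc.measurableSet).2 ?_
      filter_upwards [ae_all_iff.2 hη] with ω hω using ⟨fun i => (hω i).1, fun i => (hω i).2⟩
    have := integrable_of_ae_mem_compact isCompact_Icc hK
      (show Continuous fun x => Real.exp (s * f x) by fun_prop)
    exact (integrable_map_measure (by fun_prop) hmv.aemeasurable).1 this
  refine (measure_ge_le_exp_mul_mgf (m + t) hs0 hint).trans ?_
  unfold mgf
  refine (mul_le_mul_of_nonneg_left h (Real.exp_pos _).le).trans ?_
  rw [← Real.exp_add]
  refine Real.exp_le_exp.2 (le_of_eq ?_)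
  rw [hs]
  field_simp
  ring

end ShallowNet

namespace ShallowNet

variable {d n N : ℕ}

/-! ### The variation norm and the network classes -/

theorem DiscMeasure.tv_nonneg (μ : DiscMeasure d) : 0 ≤ μ.tv :=
  Finset.sum_nonneg fun _ _ => abs_nonneg _

theorem DiscMeasure.toFun_smul (a : ℝ) (μ : DiscMeasure d) :
    DiscMeasure.toFun (a • μ) = a • μ.toFun := by
  funext x
  unfold DiscMeasure.toFun
  rw [Finsupp.sum_smul_index (by simp), Pi.smul_apply, Finsupp.smul_sum]
  simp [mul_assoc]

theorem DiscMeasure.tv_smul {a : ℝ} (ha : 0 ≤ a) (μ : DiscMeasure d) :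
    DiscMeasure.tv (a • μ) = a * μ.tv := by
  unfold DiscMeasure.tv
  rw [Finsupp.sum_smul_index (by simp), Finsupp.mul_sum]
  simp [abs_mul, abs_of_nonneg ha]

theorem kappa_nonneg (f : Ball d → ℝ) : 0 ≤ kappa f := by
  refine Real.sInf_nonneg ?_
  rintro _ ⟨μ, -, rfl⟩
  exact μ.tv_nonneg

/-- Scaling is a bijection between the representations of `f` and of `a • f`. If there are none,
both infima are 0 by convention, so representability is never needed. -/
theorem kappa_smul {a : ℝ} (ha : 0 < a) (f : Ball d → ℝ) : kappa (a • f) = a * kappa f := by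
  unfold kappa
  rw [← smul_eq_mul, ← Real.sInf_smul_of_nonneg ha.le]
  congr 1
  ext r
  simp only [Set.mem_ofPred_eq, Set.mem_smul_set]
  constructor
  · rintro ⟨μ, hμ, rfl⟩
    refine ⟨_, ⟨a⁻¹ • μ, ?_, rfl⟩, ?_⟩
    · rw [DiscMeasure.toFun_smul, ← hμ, smul_smul, inv_mul_cancel₀ ha.ne', one_smul]
    · rw [smul_eq_mul, ← DiscMeasure.tv_smul ha.le, smul_smul, mul_inv_cancel₀ ha.ne', one_smul]
  · rintro ⟨_, ⟨μ, rfl, rfl⟩, rfl⟩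
    exact ⟨a • μ, (DiscMeasure.toFun_smul a μ).symm, (DiscMeasure.tv_smul ha.le μ).symm⟩

theorem smul_mem_NN (a : ℝ) {f : Ball d → ℝ} (hf : f ∈ NN d N) : a • f ∈ NN d N := by
  obtain ⟨c, w, rfl⟩ := hf
  refine ⟨fun i => a * c i, w, ?_⟩
  funext x
  simp [Finset.mul_sum, mul_assoc]

theorem smul_mem_NNR {R a : ℝ} (ha : 0 < a) {f : Ball d → ℝ} (hf : f ∈ NN d N)
    (h : a * kappa f ≤ R) : a • f ∈ NNR d N R :=
  ⟨smul_mem_NN a hf, by rwa [kappa_smul ha]⟩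

theorem smul_mem_starHull {F : Set (Ball d → ℝ)} {g : Ball d → ℝ} (hg : g ∈ F) {a : ℝ}
    (h0 : 0 ≤ a) (h1 : a ≤ 1) : a • g ∈ starHull F :=
  ⟨g, hg, a, ⟨h0, h1⟩, rfl⟩

/-! ### The empirical norm -/

variable (X : Fin n → Ball d)

theorem empNorm_nonneg (f : Ball d → ℝ) : 0 ≤ empNorm X f := Real.sqrt_nonneg _

theorem empNorm_eq_norm (f : Ball d → ℝ) :
    empNorm X f = √(1 / (n : ℝ)) * ‖WithLp.toLp 2 fun i => f (X i)‖ := by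
  rw [empNorm, Real.sqrt_mul (by positivity), EuclideanSpace.norm_eq]
  simp

theorem empNorm_smul {a : ℝ} (ha : 0 ≤ a) (f : Ball d → ℝ) :
    empNorm X (a • f) = a * empNorm X f := by
  have e : (WithLp.toLp 2 fun i => (a • f) (X i)) = a • WithLp.toLp 2 fun i => f (X i) := rfl
  rw [empNorm_eq_norm, empNorm_eq_norm, e, norm_smul, Real.norm_of_nonneg ha]
  ring

theorem empNorm_sub_le (f g h : Ball d → ℝ) :
    empNorm X (f - g) ≤ empNorm X (f - h) + empNorm X (g - h) := by
  have e : (WithLp.toLp 2 fun i => (f - g) (X i)) =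
      (WithLp.toLp 2 fun i => (f - h) (X i)) - WithLp.toLp 2 fun i => (g - h) (X i) := by
    ext i; simp
  rw [empNorm_eq_norm, empNorm_eq_norm, empNorm_eq_norm, e, ← mul_add]
  exact mul_le_mul_of_nonneg_left (norm_sub_le _ _) (Real.sqrt_nonneg _)

theorem abs_mean_mul_le (x : Fin n → ℝ) (f : Ball d → ℝ) :
    |(1 / (n : ℝ)) * ∑ i, x i * f (X i)| ≤ empNorm X f / √n * √(∑ i, x i ^ 2) := by
  have hcs := abs_real_inner_le_norm (WithLp.toLp 2 fun i => f (X i)) (WithLp.toLp 2 x)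
  rw [EuclideanSpace.norm_eq (WithLp.toLp 2 x), PiLp.inner_apply] at hcs
  simp only [RCLike.inner_apply, conj_trivial, Real.norm_eq_abs, sq_abs] at hcs
  rw [abs_mul, abs_of_nonneg (by positivity), empNorm_eq_norm]
  have e : √(1 / (n : ℝ)) / √n = 1 / n := by
    rw [Real.sqrt_div zero_le_one, Real.sqrt_one, div_div, Real.mul_self_sqrt (by positivity)]
  calc _ ≤ 1 / (n : ℝ) * (‖WithLp.toLp 2 fun i => f (X i)‖ * √(∑ i, x i ^ 2)) := by gcongr
    _ = √(1 / (n : ℝ)) / √n * (‖WithLp.toLp 2 fun i => f (X i)‖ * √(∑ i, x i ^ 2)) := by rw [e]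
    _ = _ := by ring

/-! ### The localized supremum as a function of the noise -/

/-- The supremum of `|(1/n) ∑ xᵢ f(Xᵢ)|` over the `f ∈ F` of empirical norm at most `δ`. -/
noncomputable def localSup (F : Set (Ball d → ℝ)) (δ : ℝ) (x : Fin n → ℝ) : ℝ :=
  ⨆ f : {f : Ball d → ℝ // f ∈ F ∧ empNorm X f ≤ δ}, |(1 / (n : ℝ)) * ∑ i, x i * f.1 (X i)|

variable {F : Set (Ball d → ℝ)} {δ : ℝ}

theorem localSup_bddAbove (x : Fin n → ℝ) :
    BddAbove (Set.range fun f : {f : Ball d → ℝ // f ∈ F ∧ empNorm X f ≤ δ} =>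
      |(1 / (n : ℝ)) * ∑ i, x i * f.1 (X i)|) := by
  refine ⟨δ / √n * √(∑ i, x i ^ 2), ?_⟩
  rintro _ ⟨f, rfl⟩
  refine (abs_mean_mul_le X x f.1).trans ?_
  have := f.2.2
  gcongr

theorem le_localSup (x : Fin n → ℝ) {f : Ball d → ℝ} (hf : f ∈ F) (hfδ : empNorm X f ≤ δ) :
    |(1 / (n : ℝ)) * ∑ i, x i * f (X i)| ≤ localSup X F δ x :=
  le_ciSup (localSup_bddAbove X x) ⟨f, hf, hfδ⟩

theorem localSup_nonneg (x : Fin n → ℝ) : 0 ≤ localSup X F δ x :=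
  Real.iSup_nonneg fun _ => abs_nonneg _

theorem localSup_convex : ConvexOn ℝ Set.univ (localSup X F δ) := by
  refine ⟨convex_univ, fun x _ y _ a b ha hb _ => ?_⟩
  simp only [smul_eq_mul]
  -- `F` may be empty, in which case the supremum is 0; hence the nonnegativity of the bound is also
  -- supplied.
  refine Real.iSup_le (fun f => ?_)
    (add_nonneg (mul_nonneg ha (localSup_nonneg X x)) (mul_nonneg hb (localSup_nonneg X y)))
  have e : (1 / (n : ℝ)) * ∑ i, (a • x + b • y) i * f.1 (X i) =
      a * ((1 / (n : ℝ)) * ∑ i, x i * f.1 (X i)) + b * ((1 / (n : ℝ)) * ∑ i, y i * f.1 (X i)) := by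
    simp only [Pi.add_apply, Pi.smul_apply, smul_eq_mul, add_mul, Finset.sum_add_distrib,
      mul_assoc, ← Finset.mul_sum]
    ring
  rw [e]
  refine (abs_add_le _ _).trans ?_
  rw [abs_mul a, abs_mul b, abs_of_nonneg ha, abs_of_nonneg hb]
  have h1 := le_localSup X x f.2.1 f.2.2
  have h2 := le_localSup X y f.2.1 f.2.2
  gcongr

theorem localSup_le_add (hδ : 0 ≤ δ) (x y : Fin n → ℝ) :
    localSup X F δ x ≤ localSup X F δ y + δ / √n * √(∑ i, (x i - y i) ^ 2) := by
  refine Real.iSup_le (fun f => ?_) (add_nonneg (localSup_nonneg X y) (by positivity))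
  have e : (1 / (n : ℝ)) * ∑ i, x i * f.1 (X i) =
      (1 / (n : ℝ)) * ∑ i, y i * f.1 (X i) + (1 / (n : ℝ)) * ∑ i, (x i - y i) * f.1 (X i) := by
    rw [← mul_add, ← Finset.sum_add_distrib]
    congr 1
    exact Finset.sum_congr rfl fun i _ => by ring
  rw [e]
  refine (abs_add_le _ _).trans (add_le_add (le_localSup X y f.2.1 f.2.2) ?_)
  refine (abs_mean_mul_le X (fun i => x i - y i) f.1).trans ?_
  have := f.2.2
  gcongr

/-- The localized supremum exceeds twice the complexity bound with exponentially small
probability. -/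
theorem measure_localSup_gt_le (hn : 1 ≤ n) {B : ℝ} (hB : 0 < B) (hδ : 0 < δ)
    {Ω : Type*} [MeasurableSpace Ω] (P : Measure Ω) [IsProbabilityMeasure P]
    {η : Fin n → Ω → ℝ} (hm : ∀ i, Measurable (η i)) (hi : iIndepFun η P)
    (hη : ∀ i, ∀ᵐ ω ∂P, |η i ω| ≤ 2 * B) (hF : localComplexity P X F δ η ≤ δ ^ 2) :
    P.real {ω | 2 * δ ^ 2 < localSup X F δ fun i => η i ω} ≤
      Real.exp (-(1 / 64 * (n : ℝ) * δ ^ 2 / B ^ 2)) := by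
  have hn0 : (0 : ℝ) < n := by exact_mod_cast hn
  have h := measure_convex_ge_le (D := 4 * B) (by positivity) (a := -(2 * B)) (b := 2 * B)
    (by linarith) P hm hi (fun i => (hη i).mono fun ω hω => abs_le.1 hω)
    (localSup_convex X (F := F) (δ := δ)) (L := δ / √n) (by positivity)
    (localSup_le_add X hδ.le) (sq_nonneg δ)
  -- The constant `1/64` is `1 / (4 * 4²)`: deviation `δ²`, Lipschitz constant `δ / √n`, range of
  -- length `4B`.
  have e : (δ ^ 2) ^ 2 / (4 * (δ / √n) ^ 2 * (4 * B) ^ 2) = 1 / 64 * (n : ℝ) * δ ^ 2 / B ^ 2 := by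
    rw [div_pow, Real.sq_sqrt hn0.le]
    field_simp
    norm_num
  rw [e] at h
  refine le_trans (measureReal_mono fun ω hω => ?_) h
  have hω' : 2 * δ ^ 2 < localSup X F δ fun i => η i ω := hω
  have hF' : (∫ ω, localSup X F δ (fun i => η i ω) ∂P) ≤ δ ^ 2 := hF
  simp only [Set.mem_ofPred_eq]
  linarith

/-! ### The deterministic argument -/

/-- The localized bound controls all members of the class, by the star shape of the hull. -/
theorem abs_mean_le_of_localSup_le (hδ : 0 < δ) {x : Fin n → ℝ}
    (hx : localSup X (starHull F) δ x ≤ 2 * δ ^ 2) {g : Ball d → ℝ} (hg : g ∈ F) :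
    |(1 / (n : ℝ)) * ∑ i, x i * g (X i)| ≤ 2 * δ * empNorm X g + 2 * δ ^ 2 := by
  have hg0 := empNorm_nonneg X g
  rcases le_total (empNorm X g) δ with hgδ | hgδ
  · have h1 : g ∈ starHull F := by simpa using smul_mem_starHull hg zero_le_one le_rfl
    have := (le_localSup X x h1 hgδ).trans hx
    nlinarith
  · have hpos : 0 < empNorm X g := hδ.trans_le hgδ
    have ha : 0 < δ / empNorm X g := by positivity
    have h1 := smul_mem_starHull hg ha.le ((div_le_one hpos).2 hgδ)
    have h2 : empNorm X ((δ / empNorm X g) • g) ≤ δ := by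
      rw [empNorm_smul X ha.le, div_mul_cancel₀ _ hpos.ne']
    have h3 := (le_localSup X x h1 h2).trans hx
    have e : (1 / (n : ℝ)) * ∑ i, x i * ((δ / empNorm X g) • g) (X i) =
        δ / empNorm X g * ((1 / (n : ℝ)) * ∑ i, x i * g (X i)) := by
      simp only [Pi.smul_apply, smul_eq_mul, Finset.mul_sum]
      exact Finset.sum_congr rfl fun i _ => by ring
    rw [e, abs_mul, abs_of_pos ha, div_mul_eq_mul_div, div_le_iff₀ hpos] at h3
    have h4 : |(1 / (n : ℝ)) * ∑ i, x i * g (X i)| ≤ 2 * δ * empNorm X g := by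
      refine le_of_mul_le_mul_left ?_ hδ
      linarith
    nlinarith [sq_nonneg δ]

theorem oracle_bound_of_localSup_le {R c₀ lam : ℝ} (hR : 0 < R) (hδ : 0 < δ)
    (hlam : 8 * δ ^ 2 / R ≤ lam) {x : Fin n → ℝ}
    (hx : localSup X (starHull (diffClass (NNR d N R))) δ x ≤ 2 * δ ^ 2)
    {h fhat f : Ball d → ℝ} (hfhat : fhat ∈ NN d N) (hf : f ∈ NNR d N R)
    (hopt : empNorm X (fhat - h) ^ 2 + lam * kappa fhat ≤
      c₀ * (empNorm X (f - h) ^ 2 + lam * kappa f) +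
        (2 / (n : ℝ)) * |∑ i, x i * (fhat (X i) - f (X i))|) :
    empNorm X (fhat - h) ^ 2 + lam * kappa fhat ≤
      (1 + 2 * c₀) * (empNorm X (f - h) ^ 2 + lam * kappa f) + 64 * δ ^ 2 := by
  have hk := kappa_nonneg fhat
  have hkf := kappa_nonneg f
  -- This factor brings `fhat` into the class, and `r ≥ 1` keeps `f` in it.
  set r := max 1 (kappa fhat / R) with hr
  have hr1 : 1 ≤ r := le_max_left _ _
  have hr0 : 0 < r := by linarith
  have hrk : kappa fhat / R ≤ r := le_max_right _ _
  have hri : 0 < r⁻¹ := by positivity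
  have m1 : r⁻¹ • fhat ∈ NNR d N R := smul_mem_NNR hri hfhat (by
    rw [inv_mul_le_iff₀ hr0]; rwa [div_le_iff₀ hR] at hrk)
  have m2 : r⁻¹ • f ∈ NNR d N R := smul_mem_NNR hri hf.1 (by
    rw [inv_mul_le_iff₀ hr0]; nlinarith [hf.2])
  have hg := abs_mean_le_of_localSup_le X hδ hx
    (show r⁻¹ • (fhat - f) ∈ diffClass (NNR d N R) from ⟨_, m1, _, m2, smul_sub _ _ _⟩)
  have e : (1 / (n : ℝ)) * ∑ i, x i * (r⁻¹ • (fhat - f)) (X i) =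
      r⁻¹ * ((1 / (n : ℝ)) * ∑ i, x i * (fhat (X i) - f (X i))) := by
    simp only [Pi.smul_apply, Pi.sub_apply, smul_eq_mul, Finset.mul_sum]
    exact Finset.sum_congr rfl fun i _ => by ring
  rw [e, abs_mul, abs_of_pos hri, empNorm_smul X hri.le, inv_mul_le_iff₀ hr0] at hg
  have e2 : r * (2 * δ * (r⁻¹ * empNorm X (fhat - f)) + 2 * δ ^ 2) =
      2 * δ * empNorm X (fhat - f) + 2 * δ ^ 2 * r := by
    field_simp
  rw [e2, abs_mul, abs_of_nonneg (by positivity : 0 ≤ 1 / (n : ℝ))] at hg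
  have e3 : (2 / (n : ℝ)) * |∑ i, x i * (fhat (X i) - f (X i))| =
      2 * ((1 / (n : ℝ)) * |∑ i, x i * (fhat (X i) - f (X i))|) := by ring
  rw [e3] at hopt
  have hrle : r ≤ 1 + kappa fhat / R := max_le (by linarith [div_nonneg hk hR.le]) (by linarith)
  have hpen : 8 * δ ^ 2 * (kappa fhat / R) ≤ lam * kappa fhat := by
    have := mul_le_mul_of_nonneg_right hlam hk
    calc _ = 8 * δ ^ 2 / R * kappa fhat := by ring
      _ ≤ _ := this
  have hlam0 : 0 ≤ lam := le_trans (by positivity) hlam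
  have htri := empNorm_sub_le X fhat f h
  have h1 : 4 * δ ^ 2 * r ≤ 4 * δ ^ 2 + lam * kappa fhat / 2 := by
    nlinarith [mul_le_mul_of_nonneg_left hrle (sq_nonneg δ)]
  have h2 := mul_le_mul_of_nonneg_left htri hδ.le
  have h3 : 0 ≤ lam * kappa f := mul_nonneg hlam0 hkf
  -- With `a`, `b` the distances of `fhat`, `f` to `h`, `4δ(a + b) ≤ a²/2 + b²/2 + 16δ²`. Absorbing
  -- half of the left side and doubling gives the factor `1 + 2c₀` and `40δ²`, within the stated
  -- `64δ²`.
  nlinarith [sq_nonneg (empNorm X (fhat - h) - 4 * δ), sq_nonneg (empNorm X (f - h) - 4 * δ)]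

end ShallowNet

open ShallowNet in
theorem mainTheorem5 :
    ∃ c₁ c₂ : ℝ, 0 < c₁ ∧ 0 < c₂ ∧
      ∀ (d n N : ℕ) (_ : 1 ≤ n) (X : Fin n → ShallowNet.Ball d) (h : ShallowNet.Ball d → ℝ)
        (B R c₀ lam δ : ℝ) (_ : 0 < B) (_ : 0 < R) (_ : 1 ≤ c₀) (_ : 0 < δ)
        (Ω : Type*) (_ : MeasurableSpace Ω) (P : Measure Ω) (_ : IsProbabilityMeasure P)
        (η : Fin n → Ω → ℝ) (_ : ∀ i, Measurable (η i)) (_ : iIndepFun η P)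
        (_ : ∀ i, ∫ ω, η i ω ∂P = 0) (_ : ∀ i, ∀ᵐ ω ∂P, |η i ω| ≤ 2 * B)
        (fhat : Ω → ShallowNet.Ball d → ℝ)
        (_ : ∀ᵐ ω ∂P, fhat ω ∈ ShallowNet.NN d N)
        (_ : ∀ᵐ ω ∂P, ∀ f ∈ ShallowNet.NN d N,
          ShallowNet.empNorm X (fhat ω - h) ^ 2 + lam * ShallowNet.kappa (fhat ω) ≤
            c₀ * (ShallowNet.empNorm X (f - h) ^ 2 + lam * ShallowNet.kappa f) +
              (2 / (n : ℝ)) * |∑ i, η i ω * (fhat ω (X i) - f (X i))|)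
        (_ : ShallowNet.localComplexity P X
          (ShallowNet.starHull (ShallowNet.diffClass (ShallowNet.NNR d N R))) δ η ≤ δ ^ 2)
        (_ : 8 * δ ^ 2 / R ≤ lam),
        ∃ E : Set Ω, MeasurableSet E ∧
          1 - c₁ * Real.exp (-(c₂ * (n : ℝ) * δ ^ 2 / B ^ 2)) ≤ P.real E ∧
          ∀ ω ∈ E, ∀ f ∈ ShallowNet.NNR d N R,
            ShallowNet.empNorm X (fhat ω - h) ^ 2 + lam * ShallowNet.kappa (fhat ω) ≤
              (1 + 2 * c₀) * (ShallowNet.empNorm X (f - h) ^ 2 + lam * ShallowNet.kappa f) +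
                64 * δ ^ 2 := by
  refine ⟨1, 1 / 64, one_pos, by norm_num, ?_⟩
  intro d n N hn X h B R c₀ lam δ hB hR _ hδ Ω _ P _ η hm hi _ hη fhat hNN hopt hG hlam
  set F := starHull (diffClass (NNR d N R))
  have hZ : Measurable fun ω => localSup X F δ fun i => η i ω :=
    (lipschitzWith_of_l2 (by positivity) (localSup_le_add X hδ.le)).continuous.measurable.comp
      (measurable_pi_lambda _ hm)
  have hS : MeasurableSet {ω | localSup X F δ (fun i => η i ω) ≤ 2 * δ ^ 2} :=
    measurableSet_le hZ measurable_const
  -- `fhat` need not be measurable, so its exceptional set is enclosed in a measurable null set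
  -- before being removed.
  obtain ⟨A, hAsub, hAm, hA⟩ := exists_measurable_superset_of_null (ae_iff.1 (hNN.and hopt))
  refine ⟨_, hS.diff hAm, ?_, fun ω hω f hf => ?_⟩
  · rw [measureReal_congr (sdiff_null_ae_eq_self hA)]
    have htail := measure_localSup_gt_le X (F := F) hn hB hδ P hm hi hη hG
    have hcompl := probReal_compl_eq_one_sub (μ := P) hS
    have e : {ω | localSup X F δ (fun i => η i ω) ≤ 2 * δ ^ 2}ᶜ =
        {ω | 2 * δ ^ 2 < localSup X F δ fun i => η i ω} := by
      ext ω; simp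
    rw [e] at hcompl
    linarith
  · have hgood := not_not.1 fun hc => hω.2 (hAsub hc)
    exact oracle_bound_of_localSup_le X hR hδ hlam hω.1 hgood.1 hf (hgood.2 f hf.1)
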